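/- Let $K$ be a field complete for a (nontrivial) discrete valuation, with ring of integers $\mathfrak{o}_K$, maximal ideal $\mathfrak{m}_K$ and a fixed norm $|\cdot|$ for the valuation; let $q>1$ be an integer and $n\ge 0$. The Robba ring $\mathcal{R}$ is the union over $r>0$ of the rings of Laurent series $\sum_{i\in\mathbb{Z}} c_i t^i$ over $K$ convergent for $e^{-r}\le |t|<1$. Let $\mathcal{R}^{\mathrm{bd}}$ (respectively $\mathcal{R}^{\mathrm{int}}$) be its subring of series with bounded coefficients (respectively coefficients in $\mathfrak{o}_K$). The bounded extended Robba ring $\tilde{\mathcal{R}}^{\mathrm{bd}}$ is the ring of formal sums $\sum_{i\in\mathbb{Q}} a_i u^i$ with bounded coefficients $a_i\in K$ such that for each $c>0$ the set $\{i : |a_i|\ge c\}$ is well-ordered, $|a_i|e^{-ri}\to 0$ as $i\to-\infty$ for some $r>0$, and $|a_i|e^{-si}\to 0$ as $i\to+\infty$ for all $s>0$; $\tilde{\mathcal{R}}^{\mathrm{int}}$ is its subring of series with coefficients in $\mathfrak{o}_K$. Let $\mathcal{E}$ and $\tilde{\mathcal{E}}$ be the $\mathfrak{m}_K$-adic completions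 of $\mathcal{R}^{\mathrm{bd}}$ and $\tilde{\mathcal{R}}^{\mathrm{bd}}$, that is, the completions for the topologies in which the sets $\mathfrak{m}_K^m\mathcal{R}^{\mathrm{int}}$, respectively $\mathfrak{m}_K^m\tilde{\mathcal{R}}^{\mathrm{int}}$ ($m\ge 0$), are a basis of neighbourhoods of $0$ (equivalently, the completions for the supremum norm on coefficients). (1) Let $\phi_K$ be an isometric field endomorphism of $K$, and let $\phi$ act on $\tilde{\mathcal{R}}^{\mathrm{bd}}$ by $\sum_i a_i u^i\mapsto\sum_i\phi_K(a_i)u^{qi}$ and on $\tilde{\mathcal{E}}$ by continuity. Let $A$ be an $n\times n$ matrix over $\tilde{\mathcal{R}}^{\mathrm{int}}$. If $\mathbf{v}\in\tilde{\mathcal{E}}^n$ satisfies $A\mathbf{v}=\phi(\mathbf{v})$, then $\mathbf{v}\in(\tilde{\mathcal{R}}^{\mathrm{bd}})^n$. (2) Let $\phi$ be a relative $q$-power Frobenius lift on $\mathcal{R}$, that is, a ring endomorphism of the form $\sum_i c_i t^i\mapsto\sum_i\phi_K(c_i)w^i$, where $\phi_K$ is an isometric field endomorphism of $K$ and $w\in\mathcal{R}^{\mathrm{int}}$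 is such that $w-t^q$ lies in the maximal ideal of $\mathcal{R}^{\mathrm{int}}$ (i.e. all its coefficients have norm less than $1$); extend its restriction to $\mathcal{R}^{\mathrm{bd}}$ to $\mathcal{E}$ by continuity. Let $A$ be an $n\times n$ matrix over $\mathcal{R}^{\mathrm{int}}$. If $\mathbf{v}\in\mathcal{E}^n$ satisfies $A\mathbf{v}=\phi(\mathbf{v})$, then $\mathbf{v}\in(\mathcal{R}^{\mathrm{bd}})^n$. -/

import Mathlib

open Filter Topology

set_option linter.unusedSectionVars false

namespace RelFrob

/-- A linearly ordered group of real exponents (below only `ℤ` and `ℚ` are used). -/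
class RealExponents (Γ : Type) [AddCommGroup Γ] [LinearOrder Γ] where
  toReal : Γ →+ ℝ
  strictMono : StrictMono toReal
  tendsto_atTop : Tendsto toReal atTop atTop

noncomputable instance : RealExponents ℤ where
  toReal := Int.castAddHom ℝ
  strictMono := Int.cast_strictMono
  tendsto_atTop := tendsto_intCast_atTop_atTop

noncomputable instance : RealExponents ℚ where
  toReal := Rat.castHom ℝ
  strictMono := Rat.cast_strictMono
  tendsto_atTop := tendsto_ratCast_atTop_iff.2 tendsto_id

section Series

open scoped Pointwise

variable {Γ : Type} [AddCommGroup Γ] [LinearOrder Γ] [IsOrderedAddMonoid Γ] [RealExponents Γ]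
variable {K : Type*} [NontriviallyNormedField K] [IsUltrametricDist K] [CompleteSpace K]

/-- The real number attached to an exponent. -/
abbrev expo (i : Γ) : ℝ := RealExponents.toReal i

/-- The formal sum `∑ a_i t^i` lies in the ring of radius `r`: for each `c > 0` the set of `i`
with `|a_i| ≥ c` is well-ordered, `|a_i| e^{-ri} → 0` as `i → -∞`, and `|a_i| e^{-si} → 0` as
`i → +∞` for each `s > 0`; moreover the coefficients are bounded on bounded sets of exponents.

For `Γ = ℤ` the first and the last clause are automatic, and this says that the Laurent series
converges on `e^{-r} ≤ |t| < 1`. The last clause is also automatic for series with bounded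
coefficients; for unbounded ones with `Γ = ℚ` it is what makes all products converge. -/
structure OnAnnulus (r : ℝ) (a : Γ → K) : Prop where
  wellOrdered : ∀ c > 0, {i | c ≤ ‖a i‖}.IsWF
  tendsto_atBot : Tendsto (fun i => ‖a i‖ * Real.exp (-(r * expo i))) atBot (𝓝 0)
  tendsto_atTop : ∀ s > 0, Tendsto (fun i => ‖a i‖ * Real.exp (-(s * expo i))) atTop (𝓝 0)
  locallyBounded : ∀ x y : Γ, ∃ M, ∀ i ∈ Set.Icc x y, ‖a i‖ ≤ M

theorem OnAnnulus.bound {r : ℝ} {a : Γ → K} (h : OnAnnulus r a) {s : ℝ} (hs : 0 < s)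
    (hsr : s ≤ r) : ∃ C, ∀ i, ‖a i‖ ≤ C * Real.exp (s * expo i) := by
  obtain ⟨x, hx⟩ := eventually_atBot.1 (h.tendsto_atBot.eventually (ge_mem_nhds one_pos))
  obtain ⟨y, hy⟩ := eventually_atTop.1 ((h.tendsto_atTop s hs).eventually (ge_mem_nhds one_pos))
  obtain ⟨M, hM⟩ := h.locallyBounded (min x 0) y
  have key : ∀ (b w : ℝ), b * Real.exp (-w) ≤ 1 → b ≤ Real.exp w := by
    intro b w hb
    rw [Real.exp_neg, ← div_eq_mul_inv, div_le_one (Real.exp_pos _)] at hb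
    exact hb
  have hC0 : 0 ≤ |M| * Real.exp (-(s * expo (min x 0))) := by positivity
  refine ⟨1 + |M| * Real.exp (-(s * expo (min x 0))), fun i => ?_⟩
  have hbig : Real.exp (s * expo i) ≤
      (1 + |M| * Real.exp (-(s * expo (min x 0)))) * Real.exp (s * expo i) :=
    le_mul_of_one_le_left (Real.exp_pos _).le (by linarith)
  rcases le_total y i with hi | hi
  · exact (key _ _ (hy i hi)).trans hbig
  rcases le_total i (min x 0) with hi' | hi'
  · refine (key _ _ (hx i (hi'.trans (min_le_left _ _)))).trans (le_trans ?_ hbig)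
    have h0 : expo i ≤ 0 := by
      have := RealExponents.strictMono.monotone (hi'.trans (min_le_right x 0))
      simpa using this
    exact Real.exp_le_exp.2 (mul_le_mul_of_nonpos_right hsr h0)
  · have h1 := hM i ⟨hi', hi⟩
    have h2 : expo (min x 0) ≤ expo i := RealExponents.strictMono.monotone hi'
    have h3 : 1 ≤ Real.exp (-(s * expo (min x 0))) * Real.exp (s * expo i) := by
      rw [← Real.exp_add, Real.one_le_exp_iff]
      nlinarith
    calc ‖a i‖ ≤ |M| := h1.trans (le_abs_self M)
      _ ≤ |M| * (Real.exp (-(s * expo (min x 0))) * Real.exp (s * expo i)) :=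
          le_mul_of_one_le_right (abs_nonneg _) h3
      _ ≤ _ := by nlinarith [Real.exp_pos (s * expo i)]

theorem tendsto_expo_atBot : Tendsto (expo : Γ → ℝ) atBot atBot := by
  have h : Tendsto (fun i : Γ => -(expo (-i) : ℝ)) atBot atBot :=
    tendsto_neg_atTop_atBot.comp (RealExponents.tendsto_atTop.comp tendsto_neg_atBot_atTop)
  simpa using h

theorem OnAnnulus.of_bound {r : ℝ} (hr : 0 < r) {a : Γ → K}
    (hw : ∀ c > 0, {i | c ≤ ‖a i‖}.IsWF)
    (hb : ∀ s, 0 < s → s ≤ r → ∃ C, ∀ i, ‖a i‖ ≤ C * Real.exp (s * expo i)) :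
    OnAnnulus (r / 2) a := by
  refine ⟨hw, ?_, fun s hs => ?_, fun x y => ?_⟩
  · obtain ⟨C, hC⟩ := hb r hr le_rfl
    have h1 : Tendsto (fun i : Γ => C * Real.exp (r / 2 * expo i)) atBot (𝓝 (C * 0)) :=
      (Real.tendsto_exp_atBot.comp
        (tendsto_expo_atBot.const_mul_atBot (half_pos hr))).const_mul C
    rw [mul_zero] at h1
    refine squeeze_zero (fun i => by positivity) (fun i => ?_) h1
    calc ‖a i‖ * Real.exp (-(r / 2 * expo i))
        ≤ C * Real.exp (r * expo i) * Real.exp (-(r / 2 * expo i)) :=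
          mul_le_mul_of_nonneg_right (hC i) (Real.exp_pos _).le
      _ = C * Real.exp (r / 2 * expo i) := by
          rw [mul_assoc, ← Real.exp_add]; ring_nf
  · have hp : 0 < min r (s / 2) := lt_min hr (half_pos hs)
    obtain ⟨C, hC⟩ := hb (min r (s / 2)) hp (min_le_left _ _)
    have hlt : 0 < s - min r (s / 2) := by linarith [min_le_right r (s / 2)]
    have h1 : Tendsto (fun i : Γ => C * Real.exp (-((s - min r (s / 2)) * expo i))) atTop
        (𝓝 (C * 0)) :=
      (Real.tendsto_exp_neg_atTop_nhds_zero.comp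
        (RealExponents.tendsto_atTop.const_mul_atTop hlt)).const_mul C
    rw [mul_zero] at h1
    refine squeeze_zero (fun i => by positivity) (fun i => ?_) h1
    calc ‖a i‖ * Real.exp (-(s * expo i))
        ≤ C * Real.exp (min r (s / 2) * expo i) * Real.exp (-(s * expo i)) :=
          mul_le_mul_of_nonneg_right (hC i) (Real.exp_pos _).le
      _ = C * Real.exp (-((s - min r (s / 2)) * expo i)) := by
          rw [mul_assoc, ← Real.exp_add]; ring_nf
  · obtain ⟨C, hC⟩ := hb r hr le_rfl
    refine ⟨|C| * Real.exp (r * expo y), fun i hi => (hC i).trans ?_⟩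
    have : expo i ≤ (expo y : ℝ) := RealExponents.strictMono.monotone hi.2
    gcongr
    exact le_abs_self C

/-- The union over `r > 0` of the rings of radius `r`. -/
def InRobba (a : Γ → K) : Prop := ∃ r > 0, OnAnnulus r a

/-- A working form of the growth conditions. -/
theorem inRobba_iff {a : Γ → K} : InRobba a ↔ (∀ c > 0, {i | c ≤ ‖a i‖}.IsWF) ∧
    ∃ r > 0, ∀ s, 0 < s → s ≤ r → ∃ C, ∀ i, ‖a i‖ ≤ C * Real.exp (s * expo i) :=
  ⟨fun ⟨r, hr, h⟩ => ⟨h.wellOrdered, r, hr, fun _ hs hsr => h.bound hs hsr⟩,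
    fun ⟨hw, r, hr, hb⟩ => ⟨r / 2, half_pos hr, .of_bound hr hw hb⟩⟩

theorem InRobba.add {a b : Γ → K} (ha : InRobba a) (hb : InRobba b) : InRobba (a + b) := by
  rw [inRobba_iff] at *
  obtain ⟨wa, r, hr, ba⟩ := ha
  obtain ⟨wb, r', hr', bb⟩ := hb
  refine ⟨fun c hc => ?_, min r r', lt_min hr hr', fun s hs hsr => ?_⟩
  · refine ((wa c hc).union (wb c hc)).mono fun i hi => ?_
    have h1 : c ≤ max ‖a i‖ ‖b i‖ := le_trans hi (IsUltrametricDist.norm_add_le_max _ _)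
    exact le_max_iff.1 h1
  · obtain ⟨C, hC⟩ := ba s hs (hsr.trans (min_le_left _ _))
    obtain ⟨D, hD⟩ := bb s hs (hsr.trans (min_le_right _ _))
    refine ⟨C + D, fun i => (norm_add_le _ _).trans ?_⟩
    rw [add_mul]
    exact add_le_add (hC i) (hD i)

theorem InRobba.neg {a : Γ → K} (ha : InRobba a) : InRobba (-a) := by
  rw [inRobba_iff] at *
  simpa using ha

theorem InRobba.single (i : Γ) (x : K) : InRobba (Pi.single i x : Γ → K) := by
  rw [inRobba_iff]
  refine ⟨fun c hc => (Set.finite_singleton i).isWF.mono fun j hj => ?_, 1, one_pos,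
    fun s hs _ => ⟨‖x‖ * Real.exp (-(s * expo i)), fun j => ?_⟩⟩
  · by_contra hne
    rw [Set.mem_ofPred_eq, Pi.single_eq_of_ne hne, norm_zero] at hj
    exact absurd hj (not_le.2 hc)
  · by_cases h : j = i
    · subst h
      rw [Pi.single_eq_same, mul_assoc, ← Real.exp_add]
      simp
    · rw [Pi.single_eq_of_ne h, norm_zero]
      positivity

theorem InRobba.zero : InRobba (0 : Γ → K) := by
  simpa using InRobba.single (0 : Γ) (0 : K)

/-- Indices of non-small terms of a triple product, with total degree bounded above, lie in
well-ordered sets. -/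
theorem InRobba.triple {a b c : Γ → K} (ha : InRobba a) (hb : InRobba b) (hc : InRobba c)
    (N : ℝ) {ε : ℝ} (hε : 0 < ε) : ∃ P Q R : Set Γ, P.IsPWO ∧ Q.IsPWO ∧ R.IsPWO ∧
      ∀ i j k, expo i + expo j + expo k ≤ N → ε ≤ ‖a i‖ * ‖b j‖ * ‖c k‖ →
        i ∈ P ∧ j ∈ Q ∧ k ∈ R := by
  obtain ⟨wa, ra, hra, ba⟩ := inRobba_iff.1 ha
  obtain ⟨wb, rb, hrb, bb⟩ := inRobba_iff.1 hb
  obtain ⟨wc, rc, hrc, bc⟩ := inRobba_iff.1 hc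
  obtain ⟨s, hs, hsa, hsb, hsc⟩ : ∃ s > 0, 2 * s ≤ ra ∧ 2 * s ≤ rb ∧ 2 * s ≤ rc := by
    refine ⟨min ra (min rb rc) / 2, by positivity, ?_, ?_, ?_⟩
    · linarith [min_le_left ra (min rb rc)]
    · linarith [min_le_right ra (min rb rc), min_le_left rb rc]
    · linarith [min_le_right ra (min rb rc), min_le_right rb rc]
  have key : ∀ (x : Γ → K) (r : ℝ), 2 * s ≤ r →
      (∀ s, 0 < s → s ≤ r → ∃ C, ∀ i, ‖x i‖ ≤ C * Real.exp (s * expo i)) →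
      ∃ C > 0, ∀ i, ‖x i‖ ≤ C * Real.exp (s * expo i - s * max (-expo i) 0) := by
    intro x r hr h
    obtain ⟨C, hC⟩ := h s hs (by linarith)
    obtain ⟨D, hD⟩ := h (2 * s) (by linarith) hr
    refine ⟨|C| + |D| + 1, by positivity, fun i => ?_⟩
    rcases le_total 0 (expo i : ℝ) with hi | hi
    · rw [max_eq_right (by linarith), mul_zero, sub_zero]
      refine (hC i).trans ?_
      gcongr
      linarith [le_abs_self C, abs_nonneg D]
    · rw [max_eq_left (by linarith)]
      have : s * expo i - s * -expo i = 2 * s * expo i := by ring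
      rw [this]
      refine (hD i).trans ?_
      gcongr
      linarith [le_abs_self D, abs_nonneg C]
  obtain ⟨A, hA0, hA⟩ := key a ra hsa ba
  obtain ⟨B, hB0, hB⟩ := key b rb hsb bb
  obtain ⟨C, hC0, hC⟩ := key c rc hsc bc
  obtain ⟨L, hL⟩ : ∃ L, L = N - Real.log (ε / (A * B * C)) / s := ⟨_, rfl⟩
  -- total negative part is at most `L`
  have hneg : ∀ i j k : Γ, expo i + expo j + expo k ≤ N → ε ≤ ‖a i‖ * ‖b j‖ * ‖c k‖ →
      max (-expo i) 0 + max (-expo j) 0 + max (-expo k) (0 : ℝ) ≤ L := by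
    intro i j k hN he
    have h1 : ε ≤ (A * B * C) * Real.exp (s * N - s * (max (-expo i) 0 + max (-expo j) 0 +
        max (-expo k) 0)) := by
      calc ε ≤ ‖a i‖ * ‖b j‖ * ‖c k‖ := he
        _ ≤ (A * Real.exp (s * expo i - s * max (-expo i) 0)) *
            (B * Real.exp (s * expo j - s * max (-expo j) 0)) *
            (C * Real.exp (s * expo k - s * max (-expo k) 0)) := by
          gcongr
          · exact hA i
          · exact hB j
          · exact hC k
        _ = (A * B * C) * Real.exp (s * (expo i + expo j + expo k) - s * (max (-expo i) 0 +
              max (-expo j) 0 + max (-expo k) 0)) := by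
          rw [show s * (expo i + expo j + expo k) - s * (max (-expo i) 0 +
              max (-expo j) 0 + max (-expo k) 0) = (s * expo i - s * max (-expo i) 0) +
              (s * expo j - s * max (-expo j) 0) + (s * expo k - s * max (-expo k) 0) by ring,
            Real.exp_add, Real.exp_add]
          ring
        _ ≤ _ := by gcongr
    have hABC : 0 < A * B * C := by positivity
    rw [← div_le_iff₀' hABC, ← Real.log_le_iff_le_exp (by positivity)] at h1
    rw [hL, le_sub_iff_add_le, ← le_sub_iff_add_le', div_le_iff₀ hs]
    linarith
  obtain ⟨M, hM1, hM⟩ : ∃ M > 0, ∀ x : ℝ, x ≤ N + 2 * L → ∀ E, 0 < E → E ≤ A + B + C →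
      E * Real.exp (s * x - s * max (-x) 0) ≤ M := by
    refine ⟨(A + B + C) * Real.exp (s * (N + 2 * L)), by positivity, fun x hx E hE0 hE => ?_⟩
    have : s * x - s * max (-x) 0 ≤ s * (N + 2 * L) := by
      have := mul_nonneg hs.le (le_max_right (-x) 0)
      nlinarith
    gcongr
  have hε' : 0 < ε / (M * M) := by positivity
  refine ⟨_, _, _, (wa _ hε').isPWO, (wb _ hε').isPWO, (wc _ hε').isPWO, ?_⟩
  intro i j k hN he
  have hn := hneg i j k hN he
  have i1 := le_max_left (-expo i) (0 : ℝ)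
  have i2 := le_max_right (-expo i) (0 : ℝ)
  have j1 := le_max_left (-expo j) (0 : ℝ)
  have j2 := le_max_right (-expo j) (0 : ℝ)
  have k1 := le_max_left (-expo k) (0 : ℝ)
  have k2 := le_max_right (-expo k) (0 : ℝ)
  have ai : ‖a i‖ ≤ M := (hA i).trans (hM _ (by linarith) A hA0 (by linarith))
  have bj : ‖b j‖ ≤ M := (hB j).trans (hM _ (by linarith) B hB0 (by linarith))
  have ck : ‖c k‖ ≤ M := (hC k).trans (hM _ (by linarith) C hC0 (by linarith))
  simp only [Set.mem_ofPred_eq, div_le_iff₀ (mul_pos hM1 hM1)]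
  refine ⟨he.trans ?_, he.trans ?_, he.trans ?_⟩
  · rw [mul_assoc]; gcongr
  · rw [mul_comm ‖a i‖, mul_assoc]; gcongr
  · rw [mul_comm]; gcongr

/-- The family of triple products of given total degree tends to zero. -/
theorem InRobba.summable_triple {a b c : Γ → K} (ha : InRobba a) (hb : InRobba b)
    (hc : InRobba c) (n : Γ) :
    Summable fun p : Γ × Γ => a p.1 * b p.2 * c (n - p.1 - p.2) := by
  refine NonarchimedeanAddGroup.summable_of_tendsto_cofinite_zero ?_
  rw [tendsto_zero_iff_norm_tendsto_zero, Metric.tendsto_nhds]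
  intro ε hε
  obtain ⟨P, Q, R, hP, hQ, hR, h⟩ := ha.triple hb hc (expo n) hε
  rw [eventually_cofinite]
  have hPQ : (P + Q).IsPWO := hP.add hQ
  have f1 := Set.AddAntidiagonal.finite_of_isPWO hPQ hR n
  have f2 := (f1.image Prod.fst).biUnion fun m _ =>
    Set.AddAntidiagonal.finite_of_isPWO hP hQ m
  refine f2.subset fun p hp => ?_
  simp only [dist_zero_right, norm_norm, not_lt, Set.mem_ofPred_eq, norm_mul] at hp
  obtain ⟨h1, h2, h3⟩ := h p.1 p.2 (n - p.1 - p.2) (by simp [expo]) hp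
  have h4 : p.1 + p.2 + (n - p.1 - p.2) = n := by abel
  exact Set.mem_biUnion (x := p.1 + p.2)
    ⟨(p.1 + p.2, n - p.1 - p.2), ⟨⟨p.1, h1, p.2, h2, rfl⟩, h3, h4⟩, rfl⟩ ⟨h1, h2, rfl⟩

/-- Convolution of coefficient families, an infinite sum in `K`. -/
noncomputable def conv (a b : Γ → K) (n : Γ) : K := ∑' i, a i * b (n - i)

theorem InRobba.summable_conv {a b : Γ → K} (ha : InRobba a) (hb : InRobba b) (n : Γ) :
    Summable fun i => a i * b (n - i) := by
  have h := ha.summable_triple (InRobba.single (0 : Γ) (1 : K)) hb n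
  have h' := h.comp_injective (i := fun i : Γ => (i, (0 : Γ)))
    (fun x y hxy => (Prod.mk.inj hxy).1)
  simpa [Function.comp_def] using h'

theorem norm_conv_le {a b : Γ → K} {n : Γ} {M : ℝ} (hM : 0 ≤ M)
    (h : ∀ i, ‖a i‖ * ‖b (n - i)‖ ≤ M) : ‖conv a b n‖ ≤ M :=
  IsUltrametricDist.norm_tsum_le_of_forall_le_of_nonneg hM fun i => by
    rw [norm_mul]; exact h i

theorem InRobba.conv {a b : Γ → K} (ha : InRobba a) (hb : InRobba b) :
    InRobba (conv a b) := by
  rw [inRobba_iff]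
  constructor
  · intro ε hε
    have htrunc : ∀ N : Γ, ({n | ε ≤ ‖RelFrob.conv a b n‖} ∩ Set.Iic N).IsWF := by
      intro N
      obtain ⟨P, Q, R, hP, hQ, -, h⟩ :=
        ha.triple hb (InRobba.single (0 : Γ) (1 : K)) (expo N) (half_pos hε)
      refine (hP.add hQ).isWF.mono fun n hn => ?_
      by_contra hcon
      have hle : ‖RelFrob.conv a b n‖ ≤ ε / 2 := by
        refine norm_conv_le (half_pos hε).le fun i => ?_
        by_contra! hlt
        have hnN : (expo n : ℝ) ≤ expo N := RealExponents.strictMono.monotone hn.2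
        obtain ⟨h1, h2, -⟩ := h i (n - i) 0 (by simpa [expo] using hnN) (by simpa using hlt.le)
        exact hcon ⟨i, h1, n - i, h2, by simp⟩
      linarith [hn.1.out]
    rw [Set.isWF_iff_no_descending_seq]
    intro f hf hmem
    have := (Set.isWF_iff_no_descending_seq.1 (htrunc (f 0))) f hf
    exact this fun n => ⟨hmem n, hf.antitone (Nat.zero_le n)⟩
  · obtain ⟨-, ra, hra, ba⟩ := inRobba_iff.1 ha
    obtain ⟨-, rb, hrb, bb⟩ := inRobba_iff.1 hb
    refine ⟨min ra rb, lt_min hra hrb, fun s hs hsr => ?_⟩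
    obtain ⟨A, hA⟩ := ba s hs (hsr.trans (min_le_left _ _))
    obtain ⟨B, hB⟩ := bb s hs (hsr.trans (min_le_right _ _))
    have hA0 : 0 ≤ A := by
      have := (norm_nonneg _).trans (hA 0)
      simpa [expo] using this
    have hB0 : 0 ≤ B := by
      have := (norm_nonneg _).trans (hB 0)
      simpa [expo] using this
    refine ⟨A * B, fun n => norm_conv_le (by positivity) fun i => ?_⟩
    calc ‖a i‖ * ‖b (n - i)‖
        ≤ (A * Real.exp (s * expo i)) * (B * Real.exp (s * expo (n - i))) := by
          gcongr
          · exact hA i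
          · exact hB _
      _ = A * B * Real.exp (s * expo n) := by
          rw [mul_mul_mul_comm, ← Real.exp_add]
          simp only [expo, map_sub]
          ring_nf

theorem conv_comm (a b : Γ → K) : conv a b = conv b a := by
  funext n
  rw [conv, conv, ← (Equiv.subLeft n).tsum_eq]
  simp [mul_comm]

theorem conv_assoc {a b c : Γ → K} (ha : InRobba a) (hb : InRobba b) (hc : InRobba c) :
    conv (conv a b) c = conv a (conv b c) := by
  funext n
  have hs := ha.summable_triple hb hc n
  have hr : conv a (conv b c) n = ∑' p : Γ × Γ, a p.1 * b p.2 * c (n - p.1 - p.2) := by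
    rw [hs.tsum_prod]
    refine tsum_congr fun i => ?_
    rw [conv, ← tsum_mul_left]
    simp only [mul_assoc]
  -- reindex by the sum of the first two exponents
  let e : Γ × Γ ≃ Γ × Γ :=
    { toFun := fun p => (p.2, p.1 - p.2)
      invFun := fun p => (p.1 + p.2, p.1)
      left_inv := fun p => by simp
      right_inv := fun p => by simp }
  have hs' : Summable fun p : Γ × Γ => a p.2 * b (p.1 - p.2) * c (n - p.1) := by
    have := e.summable_iff.2 hs
    refine this.congr fun p => ?_
    simp [e]
  have hl : conv (conv a b) c n = ∑' p : Γ × Γ, a p.2 * b (p.1 - p.2) * c (n - p.1) := by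
    rw [hs'.tsum_prod]
    refine tsum_congr fun i => ?_
    rw [conv, ← tsum_mul_right]
  rw [hl, hr, ← e.tsum_eq fun p : Γ × Γ => a p.1 * b p.2 * c (n - p.1 - p.2)]
  refine tsum_congr fun p => ?_
  simp [e]

theorem single_conv (b : Γ → K) : conv (Pi.single 0 1) b = b := by
  funext n
  rw [conv, tsum_eq_single 0]
  · simp
  · intro i hi
    simp [hi]

theorem conv_add {a b c : Γ → K} (ha : InRobba a) (hb : InRobba b) (hc : InRobba c) :
    conv a (b + c) = conv a b + conv a c := by
  funext n
  simp only [conv, Pi.add_apply, mul_add]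
  exact (ha.summable_conv hb n).tsum_add (ha.summable_conv hc n)

variable (Γ K)

/-- The Robba ring with exponents in `Γ`, as an additive group of families of coefficients. -/
def robba : AddSubgroup (Γ → K) where
  carrier := {a | InRobba a}
  add_mem' := InRobba.add
  zero_mem' := InRobba.zero
  neg_mem' := InRobba.neg

/-- The Robba ring over `K` with exponents in `Γ`: for `Γ = ℤ` the Robba ring `ℛ`, for `Γ = ℚ`
the extended Robba ring `ℛ̃`. -/
def Robba : Type _ := robba Γ K

noncomputable instance instCommRingRobba : CommRing (Robba Γ K) :=
  { (inferInstance : AddCommGroup (robba Γ K)) with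
    mul := fun a b => ⟨conv a.1 b.1, InRobba.conv a.2 b.2⟩
    one := ⟨Pi.single 0 1, InRobba.single 0 1⟩
    mul_assoc := fun a b c => Subtype.ext (conv_assoc a.2 b.2 c.2)
    mul_comm := fun a b => Subtype.ext (conv_comm a.1 b.1)
    one_mul := fun a => Subtype.ext (single_conv a.1)
    mul_one := fun a => Subtype.ext ((conv_comm _ _).trans (single_conv a.1))
    left_distrib := fun a b c => Subtype.ext (conv_add a.2 b.2 c.2)
    right_distrib := fun a b c => Subtype.ext (by
      change conv (a.1 + b.1) c.1 = conv a.1 c.1 + conv b.1 c.1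
      rw [conv_comm, conv_add c.2 a.2 b.2, conv_comm c.1, conv_comm c.1])
    zero_mul := fun a => Subtype.ext (by
      change conv (0 : Γ → K) a.1 = 0
      funext n; simp [conv])
    mul_zero := fun a => Subtype.ext (by
      change conv a.1 (0 : Γ → K) = 0
      funext n; simp [conv]) }

variable {Γ K}

/-- The coefficient of `t^i`. -/
def coeff (i : Γ) (f : Robba Γ K) : K := f.1 i

theorem Robba.ext {f g : Robba Γ K} (h : ∀ i, coeff i f = coeff i g) : f = g :=
  Subtype.ext (funext h)

@[simp] theorem coeff_add (i : Γ) (f g : Robba Γ K) : coeff i (f + g) = coeff i f + coeff i g :=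
  rfl

@[simp] theorem coeff_neg (i : Γ) (f : Robba Γ K) : coeff i (-f) = -coeff i f := rfl

@[simp] theorem coeff_zero (i : Γ) : coeff i (0 : Robba Γ K) = 0 := rfl

theorem coeff_mul (n : Γ) (f g : Robba Γ K) :
    coeff n (f * g) = ∑' i, coeff i f * coeff (n - i) g := rfl

/-- The monomial `x t^i`. -/
def monomial (i : Γ) (x : K) : Robba Γ K := ⟨Pi.single i x, InRobba.single i x⟩

theorem one_eq_monomial : (1 : Robba Γ K) = monomial 0 1 := rfl

theorem norm_coeff_mul_le {f g : Robba Γ K} {C D : ℝ} (hf : ∀ i, ‖coeff i f‖ ≤ C)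
    (hg : ∀ i, ‖coeff i g‖ ≤ D) (n : Γ) : ‖coeff n (f * g)‖ ≤ C * D := by
  have hC : 0 ≤ C := (norm_nonneg _).trans (hf 0)
  have hD : 0 ≤ D := (norm_nonneg _).trans (hg 0)
  exact norm_conv_le (by positivity) fun i => mul_le_mul (hf i) (hg _) (norm_nonneg _) hC

theorem norm_coeff_one_le (i : Γ) : ‖coeff i (1 : Robba Γ K)‖ ≤ 1 := by
  change ‖(Pi.single 0 1 : Γ → K) i‖ ≤ 1
  by_cases h : i = 0
  · subst h; simp
  · simp [h]

variable (Γ K)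

/-- The subring of series with bounded coefficients. -/
def bd : Subring (Robba Γ K) where
  carrier := {f | ∃ C, ∀ i, ‖coeff i f‖ ≤ C}
  mul_mem' := fun ⟨_, hC⟩ ⟨_, hD⟩ => ⟨_, norm_coeff_mul_le hC hD⟩
  one_mem' := ⟨1, norm_coeff_one_le⟩
  add_mem' := fun ⟨C, hC⟩ ⟨D, hD⟩ =>
    ⟨C + D, fun i => (norm_add_le _ _).trans (add_le_add (hC i) (hD i))⟩
  zero_mem' := ⟨0, fun i => by simp⟩
  neg_mem' := fun ⟨C, hC⟩ => ⟨C, fun i => by simpa using hC i⟩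

/-- The subring of series with integral coefficients. -/
def int : Subring (Robba Γ K) where
  carrier := {f | ∀ i, ‖coeff i f‖ ≤ 1}
  mul_mem' := fun hf hg n => by simpa using norm_coeff_mul_le hf hg n
  one_mem' := norm_coeff_one_le
  add_mem' := fun hf hg i =>
    (IsUltrametricDist.norm_add_le_max _ _).trans (max_le (hf i) (hg i))
  zero_mem' := fun i => by simp
  neg_mem' := fun hf i => by simpa using hf i

/-- The bounded Robba ring. -/
abbrev RobbaBd : Type _ := bd Γ K

/-- The integral Robba ring. -/
abbrev RobbaInt : Type _ := int Γ K

/-- The inclusion of the integral into the bounded Robba ring. -/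
noncomputable def intToBd : RobbaInt Γ K →+* RobbaBd Γ K :=
  Subring.inclusion fun _ hf => ⟨1, hf⟩

variable {Γ K}

/-- The Gauss norm, the supremum of the norms of the coefficients. -/
noncomputable def gauss (f : RobbaBd Γ K) : ℝ := ⨆ i, ‖coeff i f.1‖

theorem norm_coeff_le_gauss (f : RobbaBd Γ K) (i : Γ) : ‖coeff i f.1‖ ≤ gauss f :=
  le_ciSup (f := fun i => ‖coeff i f.1‖)
    (by obtain ⟨C, hC⟩ := f.2; exact ⟨C, by rintro _ ⟨i, rfl⟩; exact hC i⟩) i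

theorem gauss_le {f : RobbaBd Γ K} {C : ℝ} (h : ∀ i, ‖coeff i f.1‖ ≤ C) : gauss f ≤ C :=
  ciSup_le h

variable (Γ K) in
/-- The Gauss norm as a ring norm. -/
noncomputable def gaussNorm : RingNorm (RobbaBd Γ K) where
  toFun := gauss
  map_zero' := le_antisymm (gauss_le fun i => by simp)
    ((norm_nonneg (coeff (0 : Γ) (0 : Robba Γ K))).trans (norm_coeff_le_gauss 0 0))
  add_le' f g := gauss_le fun i => (norm_add_le _ _).trans
    (add_le_add (norm_coeff_le_gauss f i) (norm_coeff_le_gauss g i))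
  neg' f := by simp [gauss]
  mul_le' f g :=
    gauss_le (norm_coeff_mul_le (norm_coeff_le_gauss f) (norm_coeff_le_gauss g))
  eq_zero_of_map_eq_zero' f hf := Subtype.ext (Robba.ext fun i =>
    norm_le_zero_iff.1 ((norm_coeff_le_gauss f i).trans (le_of_eq hf)))

/-- The bounded Robba ring with the topology of the Gauss norm. When the valuation of `K` is
discrete with uniformizer `π`, the closed ball of radius `|π|^n` is `𝔪_K^n` times the integral Robba
ring, so that this is the `𝔪_K`-adic topology. -/
noncomputable instance instNormedCommRingRobbaBd : NormedCommRing (RobbaBd Γ K) :=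
  { (gaussNorm Γ K).toNormedRing with
    mul_comm := mul_comm }

theorem norm_eq_gauss (f : RobbaBd Γ K) : ‖f‖ = ⨆ i, ‖coeff i f.1‖ := rfl

variable (Γ K) in
/-- The `𝔪_K`-adic completion of the bounded Robba ring. -/
abbrev RobbaCompletion : Type _ := UniformSpace.Completion (RobbaBd Γ K)

variable (Γ K) in
/-- The inclusion of the bounded Robba ring into its completion. -/
noncomputable def bdToCompletion : RobbaBd Γ K →+* RobbaCompletion Γ K :=
  UniformSpace.Completion.coeRingHom

/-- An endomorphism of the Robba ring that does not increase suprema of coefficients. -/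
def NonIncreasing (φ : Robba Γ K →+* Robba Γ K) : Prop :=
  ∀ (f : Robba Γ K) (C : ℝ), (∀ i, ‖coeff i f‖ ≤ C) → ∀ i, ‖coeff i (φ f)‖ ≤ C

/-- The restriction of an endomorphism to the bounded Robba ring. -/
noncomputable def restrictBd (φ : Robba Γ K →+* Robba Γ K) (h : NonIncreasing φ) :
    RobbaBd Γ K →+* RobbaBd Γ K :=
  φ.restrict (bd Γ K) (bd Γ K) fun f ⟨C, hC⟩ => ⟨C, h f C hC⟩

theorem continuous_restrictBd (φ : Robba Γ K →+* Robba Γ K) (h : NonIncreasing φ) :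
    Continuous (restrictBd φ h) :=
  AddMonoidHomClass.continuous_of_bound (restrictBd φ h) 1 fun f => by
    rw [one_mul]
    exact gauss_le (f := restrictBd φ h f) (h f.1 _ (norm_coeff_le_gauss f))

/-- The continuous extension of an endomorphism to the completion. -/
noncomputable def completionMap (φ : Robba Γ K →+* Robba Γ K) (h : NonIncreasing φ) :
    RobbaCompletion Γ K →+* RobbaCompletion Γ K :=
  UniformSpace.Completion.mapRingHom (restrictBd φ h) (continuous_restrictBd φ h)

end Series

section Frobenius

variable (K : Type*) [NontriviallyNormedField K] [IsUltrametricDist K] [CompleteSpace K]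

/-- A relative `q`-power Frobenius lift: an endomorphism `φ` of the Robba ring of the form
`∑ c_i t^i ↦ ∑ φ_K(c_i) u^i`, where `φ_K` is an isometric endomorphism of `K` and `u` is an
element of the integral Robba ring such that all coefficients of `u - t^q` have norm less
than `1`. (Such a `u` is a unit, which gives a meaning to its negative powers.) -/
structure RelativeFrobeniusLift (q : ℕ) where
  φK : K →+* K
  isometry : ∀ x, ‖φK x‖ = ‖x‖
  u : (RobbaInt ℤ K)ˣ
  u_sub : ∀ n : ℤ, ‖coeff n ((u : RobbaInt ℤ K).1 - monomial (q : ℤ) 1)‖ < 1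
  toRingHom : Robba ℤ K →+* Robba ℤ K
  hasSum_coeff : ∀ (f : Robba ℤ K) (n : ℤ),
    HasSum (fun i : ℤ => φK (coeff i f) * coeff n ((u ^ i : (RobbaInt ℤ K)ˣ) : RobbaInt ℤ K).1)
      (coeff n (toRingHom f))

variable {K}

theorem RelativeFrobeniusLift.nonIncreasing {q : ℕ} (φ : RelativeFrobeniusLift K q) :
    NonIncreasing φ.toRingHom := by
  intro f C hC n
  have hC0 : 0 ≤ C := (norm_nonneg _).trans (hC 0)
  rw [← (φ.hasSum_coeff f n).tsum_eq]
  refine IsUltrametricDist.norm_tsum_le_of_forall_le_of_nonneg hC0 fun i => ?_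
  rw [norm_mul, φ.isometry]
  have h1 : ‖coeff n ((φ.u ^ i : (RobbaInt ℤ K)ˣ) : RobbaInt ℤ K).1‖ ≤ 1 :=
    ((φ.u ^ i : (RobbaInt ℤ K)ˣ) : RobbaInt ℤ K).2 n
  exact (mul_le_of_le_one_right (norm_nonneg _) h1).trans (hC i)

/-- The action of a relative Frobenius lift on the completion of the bounded Robba ring. -/
noncomputable def RelativeFrobeniusLift.onCompletion {q : ℕ} (φ : RelativeFrobeniusLift K q) :
    RobbaCompletion ℤ K →+* RobbaCompletion ℤ K :=
  completionMap φ.toRingHom φ.nonIncreasing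

/-- The coefficients of `∑ φ_K(a_i) u^{qi}`. -/
theorem InRobba.frobenius {φK : K →+* K} (hφ : ∀ x, ‖φK x‖ = ‖x‖) {q : ℕ} (hq : 0 < q)
    {a : ℚ → K} (ha : InRobba a) : InRobba fun i : ℚ => φK (a (i / q)) := by
  have hq' : (0 : ℝ) < q := by exact_mod_cast hq
  have hq'' : (0 : ℚ) < q := by exact_mod_cast hq
  obtain ⟨wa, r, hr, ba⟩ := inRobba_iff.1 ha
  refine inRobba_iff.2 ⟨fun c hc => ?_, r / q, by positivity, fun s hs hsr => ?_⟩
  · rw [Set.isWF_iff_no_descending_seq]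
    intro f hf hmem
    refine (Set.isWF_iff_no_descending_seq.1 (wa c hc)) (fun n => f n / q) ?_ fun n => ?_
    · intro m n hmn
      exact div_lt_div_of_pos_right (hf hmn) hq''
    · simpa [hφ] using hmem n
  · obtain ⟨C, hC⟩ := ba (s * q) (by positivity) ((le_div_iff₀ hq').1 hsr)
    refine ⟨C, fun i => ?_⟩
    rw [hφ]
    refine (hC (i / q)).trans (le_of_eq ?_)
    congr 2
    change s * q * ((i / q : ℚ) : ℝ) = s * (i : ℝ)
    push_cast
    field_simp

/-- The endomorphism `∑ a_i u^i ↦ ∑ φ_K(a_i) u^{qi}` of the extended Robba ring. -/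
noncomputable def extendedFrobenius (φK : K →+* K) (hφ : ∀ x, ‖φK x‖ = ‖x‖) (q : ℕ)
    (hq : 0 < q) : Robba ℚ K →+* Robba ℚ K where
  toFun f := ⟨fun i => φK (coeff (i / q) f), InRobba.frobenius hφ hq f.2⟩
  map_zero' := Robba.ext fun i => map_zero φK
  map_one' := Robba.ext fun i => by
    have hq'' : (q : ℚ) ≠ 0 := by exact_mod_cast hq.ne'
    change φK ((Pi.single 0 1 : ℚ → K) (i / q)) = (Pi.single 0 1 : ℚ → K) i
    by_cases h : i = 0
    · subst h; simp
    · simp [h, hq'']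
  map_add' f g := Robba.ext fun i => map_add φK _ _
  map_mul' f g := Robba.ext fun n => by
    have hq'' : (q : ℚ) ≠ 0 := by exact_mod_cast hq.ne'
    change φK (coeff (n / q) (f * g)) =
      ∑' i : ℚ, φK (coeff (i / q) f) * φK (coeff ((n - i) / q) g)
    have hc : Continuous φK := (AddMonoidHomClass.isometry_of_norm φK hφ).continuous
    have h1 : HasSum (fun i : ℚ => coeff i f * coeff (n / q - i) g) (coeff (n / q) (f * g)) :=
      (InRobba.summable_conv f.2 g.2 (n / q)).hasSum
    rw [← (h1.map φK hc).tsum_eq, ← (Equiv.divRight₀ (q : ℚ) hq'').tsum_eq]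
    refine tsum_congr fun i => ?_
    simp [sub_div]

@[simp] theorem coeff_extendedFrobenius (φK : K →+* K) (hφ : ∀ x, ‖φK x‖ = ‖x‖) (q : ℕ)
    (hq : 0 < q) (f : Robba ℚ K) (i : ℚ) :
    coeff i (extendedFrobenius φK hφ q hq f) = φK (coeff (i / q) f) := rfl

theorem extendedFrobenius_nonIncreasing (φK : K →+* K) (hφ : ∀ x, ‖φK x‖ = ‖x‖) (q : ℕ)
    (hq : 0 < q) : NonIncreasing (extendedFrobenius φK hφ q hq) := fun f C hC i => by
  rw [coeff_extendedFrobenius, hφ]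
  exact hC _

/-- The action of Frobenius on the completion of the bounded extended Robba ring. -/
noncomputable def extendedFrobeniusCompletion (φK : K →+* K) (hφ : ∀ x, ‖φK x‖ = ‖x‖) (q : ℕ)
    (hq : 0 < q) : RobbaCompletion ℚ K →+* RobbaCompletion ℚ K :=
  completionMap (extendedFrobenius φK hφ q hq) (extendedFrobenius_nonIncreasing φK hφ q hq)

end Frobenius

end RelFrob

namespace RelFrob


/-! ### Sums in ultrametric groups -/

theorem norm_sub_le_max_norm {E : Type*} [NormedAddCommGroup E] [IsUltrametricDist E] (x y : E) :
    ‖x - y‖ ≤ max ‖x‖ ‖y‖ := by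
  simpa [sub_eq_add_neg] using IsUltrametricDist.norm_add_le_max x (-y)

/-- Some term of a convergent ultrametric series is at least as large as its nonzero sum. -/
theorem exists_norm_le_of_hasSum {ι E : Type*} [NormedAddCommGroup E] [IsUltrametricDist E]
    {g : ι → E} {s : E} (hg : HasSum g s) (hs : s ≠ 0) : ∃ i, ‖s‖ ≤ ‖g i‖ := by
  by_contra! hlt
  have h0 : 0 < ‖s‖ := norm_pos_iff.2 hs
  obtain ⟨t, ht⟩ := (hg.eventually (Metric.ball_mem_nhds s h0)).exists
  have h1 : ‖∑ i ∈ t, g i‖ < ‖s‖ := by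
    rcases t.eq_empty_or_nonempty with rfl | hne
    · simpa using h0
    · obtain ⟨i, -, hi⟩ := IsUltrametricDist.exists_norm_finsetSum_le_of_nonempty hne g
      exact hi.trans_lt (hlt i)
  have h2 := norm_sub_le_max_norm (∑ i ∈ t, g i) (∑ i ∈ t, g i - s)
  rw [sub_sub_cancel] at h2
  rw [dist_eq_norm] at ht
  exact absurd h2 (not_le.2 (max_lt h1 ht))

/-- Ultrametric triangles are isosceles. This lets an approximation with error below the size of a
coefficient preserve its norm exactly. -/
theorem norm_eq_of_norm_sub_lt {E : Type*} [NormedAddCommGroup E] [IsUltrametricDist E]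
    {x y : E} (h : ‖x - y‖ < ‖x‖) : ‖y‖ = ‖x‖ := by
  have h1 := norm_sub_le_max_norm x (x - y)
  have h2 := IsUltrametricDist.norm_add_le_max (x - y) y
  rw [sub_sub_cancel] at h1
  rw [sub_add_cancel] at h2
  rw [max_eq_left h.le] at h1
  rcases le_max_iff.1 h2 with h3 | h3
  · exact absurd h3 (not_le.2 h)
  · exact le_antisymm h1 h3

/-- A convergent ultrametric series with a strictly dominating term has the norm of that term. -/
theorem norm_eq_of_hasSum_of_dominant {ι E : Type*} [NormedAddCommGroup E]
    [IsUltrametricDist E] {g : ι → E} {s : E} (hg : HasSum g s) {k : ι} (hk : 0 < ‖g k‖)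
    (hdom : ∀ i, i ≠ k → ‖g i‖ < ‖g k‖) : ‖s‖ = ‖g k‖ := by
  classical
  refine norm_eq_of_norm_sub_lt ?_
  rw [norm_sub_rev]
  -- Zeroing the dominant term leaves a series with sum `s - g k`. No uniform gap below `‖g k‖` is
  -- needed, because some single term must be as large as that sum.
  have h1 := hg.update k 0
  rw [zero_sub, neg_add_eq_sub] at h1
  by_contra! hle
  obtain ⟨i, hi⟩ := exists_norm_le_of_hasSum h1 (norm_pos_iff.1 (hk.trans_le hle))
  by_cases hik : i = k
  · subst hik
    rw [Function.update_self, norm_zero] at hi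
    linarith
  · rw [Function.update_of_ne hik] at hi
    linarith [hdom i hik]

/-! ### Coefficients of elements of the completion -/

section Coefficients

variable {Γ : Type} [AddCommGroup Γ] [LinearOrder Γ] [IsOrderedAddMonoid Γ] [RealExponents Γ]
variable {K : Type*} [NontriviallyNormedField K] [IsUltrametricDist K] [CompleteSpace K]

variable (Γ K) in
/-- The coefficient of `t^i` as an additive map on the bounded Robba ring. -/
noncomputable def bdCoeff (i : Γ) : RobbaBd Γ K →+ K where
  toFun f := coeff i f.1
  map_zero' := rfl
  map_add' _ _ := rfl

theorem continuous_bdCoeff (i : Γ) : Continuous (bdCoeff Γ K i) :=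
  AddMonoidHomClass.continuous_of_bound (bdCoeff Γ K i) 1 fun f => by
    rw [one_mul]
    exact norm_coeff_le_gauss f i

/-- The coefficient of `t^i` on the completion of the bounded Robba ring. -/
noncomputable def completionCoeff (i : Γ) : RobbaCompletion Γ K →+ K :=
  (bdCoeff Γ K i).extension (continuous_bdCoeff i)

theorem continuous_completionCoeff (i : Γ) :
    Continuous (completionCoeff i : RobbaCompletion Γ K →+ K) :=
  AddMonoidHom.continuous_extension _ (continuous_bdCoeff i)

@[simp] theorem completionCoeff_coe (i : Γ) (f : RobbaBd Γ K) :
    completionCoeff i (bdToCompletion Γ K f) = coeff i f.1 :=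
  AddMonoidHom.extension_coe _ (continuous_bdCoeff i) f

theorem norm_bdToCompletion (f : RobbaBd Γ K) : ‖bdToCompletion Γ K f‖ = ‖f‖ :=
  UniformSpace.Completion.norm_coe f

theorem norm_completionCoeff_le (x : RobbaCompletion Γ K) (i : Γ) :
    ‖completionCoeff i x‖ ≤ ‖x‖ := by
  induction x using UniformSpace.Completion.induction_on with
  | hp => exact isClosed_le (continuous_completionCoeff i).norm continuous_norm
  | ih f =>
    have h1 : ‖bdToCompletion Γ K f‖ = ‖f‖ := norm_bdToCompletion f
    have h2 : completionCoeff i (bdToCompletion Γ K f) = coeff i f.1 := completionCoeff_coe i f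
    exact (congrArg norm h2).le.trans ((norm_coeff_le_gauss f i).trans h1.ge)

theorem denseRange_bdToCompletion : DenseRange (bdToCompletion Γ K) :=
  UniformSpace.Completion.denseRange_coe

/-- Simultaneous coefficientwise approximation of `x` and `T x` for a continuous map `T`. -/
theorem exists_approx {T : RobbaCompletion Γ K → RobbaCompletion Γ K} (hT : Continuous T)
    (x : RobbaCompletion Γ K) {ε : ℝ} (hε : 0 < ε) : ∃ f : RobbaBd Γ K,
      (∀ i, ‖completionCoeff i x - coeff i f.1‖ < ε) ∧
      ∀ i, ‖completionCoeff i (T x) - completionCoeff i (T (bdToCompletion Γ K f))‖ < ε := by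
  obtain ⟨f, h1, h2⟩ := denseRange_bdToCompletion.exists_mem_open
    ((Metric.isOpen_ball (x := x) (ε := ε)).inter
      ((Metric.isOpen_ball (x := T x) (ε := ε)).preimage hT))
    ⟨x, Metric.mem_ball_self hε, Metric.mem_ball_self hε⟩
  rw [Metric.mem_ball, dist_comm, dist_eq_norm] at h1
  rw [Set.mem_preimage, Metric.mem_ball, dist_comm, dist_eq_norm] at h2
  refine ⟨f, fun i => ?_, fun i => ?_⟩
  · rw [← completionCoeff_coe, ← map_sub]
    exact (norm_completionCoeff_le _ i).trans_lt h1
  · rw [← map_sub]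
    exact (norm_completionCoeff_le _ i).trans_lt h2

/-- An approximant of `x - y` has uniformly small coefficients, hence small Gauss norm, so `x - y`
is itself small. -/
theorem completion_ext {x y : RobbaCompletion Γ K}
    (h : ∀ i, completionCoeff i x = completionCoeff i y) : x = y := by
  rw [← sub_eq_zero, ← norm_le_zero_iff]
  refine le_of_forall_pos_le_add fun ε hε => ?_
  obtain ⟨f, h1⟩ := denseRange_bdToCompletion.exists_dist_lt (x - y) (half_pos hε)
  rw [dist_eq_norm] at h1
  have h2 : ‖f‖ ≤ ε / 2 := gauss_le fun i => by
    have h3 := norm_completionCoeff_le (x - y - bdToCompletion Γ K f) i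
    rw [map_sub, map_sub, h i, sub_self, zero_sub, norm_neg, completionCoeff_coe] at h3
    exact h3.trans h1.le
  have h4 := norm_add_le (x - y - bdToCompletion Γ K f) (bdToCompletion Γ K f)
  rw [sub_add_cancel, norm_bdToCompletion] at h4
  linarith

/-- An approximant with error below `c` has the same norms at all exponents where `x` has a
coefficient of norm at least `c`. -/
theorem isWF_completionCoeff (x : RobbaCompletion Γ K) {c : ℝ} (hc : 0 < c) :
    {i | c ≤ ‖completionCoeff i x‖}.IsWF := by
  obtain ⟨f, hf, -⟩ := exists_approx continuous_id x hc
  refine ((inRobba_iff.1 f.1.2).1 c hc).mono fun i hi => ?_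
  have h1 := norm_eq_of_norm_sub_lt ((hf i).trans_le hi)
  exact (show c ≤ ‖completionCoeff i x‖ from hi).trans h1.ge

/-- A nonzero coefficient of a product is bounded by some product of coefficients. -/
theorem exists_norm_completionCoeff_mul_le (a : RobbaInt Γ K) (x : RobbaCompletion Γ K) {n : Γ}
    (h : completionCoeff n (bdToCompletion Γ K (intToBd Γ K a) * x) ≠ 0) :
    ∃ j, ‖completionCoeff n (bdToCompletion Γ K (intToBd Γ K a) * x)‖ ≤
      ‖coeff j a.1‖ * ‖completionCoeff (n - j) x‖ := by
  -- The tolerance is the norm of the product coefficient. As `a` is integral, the coefficient of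
  -- `f` selected below is at least that large, so `x` has a coefficient of the same norm there.
  obtain ⟨f, hf, hg⟩ := exists_approx (T := fun y => bdToCompletion Γ K (intToBd Γ K a) * y)
    (continuous_const.mul continuous_id) x (norm_pos_iff.2 h)
  have h1 := norm_eq_of_norm_sub_lt (hg n)
  rw [← map_mul, completionCoeff_coe] at h1
  have h2 : HasSum (fun j => coeff j a.1 * coeff (n - j) f.1)
      (coeff n (intToBd Γ K a * f).1) := (InRobba.summable_conv a.1.2 f.1.2 n).hasSum
  obtain ⟨j, hj⟩ := exists_norm_le_of_hasSum h2
    (norm_pos_iff.1 (h1 ▸ norm_pos_iff.2 h))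
  rw [norm_mul, h1] at hj
  refine ⟨j, hj.trans_eq ?_⟩
  have h3 : ‖coeff j a.1‖ ≤ 1 := a.2 j
  have h4 := hj.trans (mul_le_of_le_one_left (norm_nonneg _) h3)
  congr 1
  refine (norm_eq_of_norm_sub_lt ?_).symm
  rw [norm_sub_rev]
  exact (hf (n - j)).trans_le h4

/-- Overconvergence of an element of the completion from a growth bound on its coefficients. -/
theorem exists_bd_of_bound (x : RobbaCompletion Γ K) {r D : ℝ} (hr : 0 < r)
    (h : ∀ i, ‖completionCoeff i x‖ ≤ D * Real.exp (r * expo i)) :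
    ∃ w : RobbaBd Γ K, x = bdToCompletion Γ K w := by
  have hx : InRobba fun i => completionCoeff i x := by
    refine inRobba_iff.2 ⟨fun c hc => isWF_completionCoeff x hc, r, hr, fun s hs hsr =>
      ⟨max ‖x‖ D, fun i => ?_⟩⟩
    have hM : 0 ≤ max ‖x‖ D := (norm_nonneg x).trans (le_max_left _ _)
    -- At nonnegative exponents boundedness suffices; at negative ones the bound for `r` implies
    -- that for every `s ≤ r`.
    rcases le_total 0 (expo i : ℝ) with hi | hi
    · refine (norm_completionCoeff_le x i).trans ((le_max_left _ D).trans ?_)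
      exact le_mul_of_one_le_right hM (Real.one_le_exp (by positivity))
    · refine (h i).trans (mul_le_mul (le_max_right _ _) (Real.exp_le_exp.2 ?_)
        (Real.exp_pos _).le hM)
      exact mul_le_mul_of_nonpos_right hsr hi
  refine ⟨⟨⟨_, hx⟩, ‖x‖, fun i => norm_completionCoeff_le x i⟩, completion_ext fun i => ?_⟩
  rw [completionCoeff_coe]
  rfl

/-- Phrased as a condition for all small `r`, so that finitely many such conditions can be met by
one radius. -/
theorem InRobba.eventually_bound {a : Γ → K} (ha : InRobba a) :
    ∀ᶠ r in 𝓝[>] (0 : ℝ), ∃ C, ∀ i, ‖a i‖ ≤ C * Real.exp (r * expo i) := by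
  obtain ⟨-, r, hr, h⟩ := inRobba_iff.1 ha
  filter_upwards [Ioc_mem_nhdsGT hr] with s hs using h s hs.1 hs.2

/-! ### Growth of solutions of the Frobenius equation -/

/-- The lower bound on the growth of `T x` expected of a lift of the `q`-power Frobenius. -/
def IsExpanding (q : ℕ) (r : ℝ) (T : RobbaCompletion Γ K → RobbaCompletion Γ K) : Prop :=
  ∀ (x : RobbaCompletion Γ K) (i : Γ) (c : ℝ), 0 < c → c ≤ ‖completionCoeff i x‖ →
    ∃ n, c ≤ ‖completionCoeff n (T x)‖ ∧
      ‖completionCoeff i x‖ * Real.exp (-(q * r * expo i)) ≤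
        ‖completionCoeff n (T x)‖ * Real.exp (-(r * expo n))

/-- Expansion by `T` bounds the weight of `v` in radius `qr` by its weight in radius `r`, which
interpolates between the former and the bounded Gauss norm. The resulting self-bound is made
legitimate by truncating at coefficients of norm at least `c`. -/
theorem exists_bd_of_mulVec_eq {q : ℕ} (hq : 1 < q)
    {T : RobbaCompletion Γ K → RobbaCompletion Γ K}
    (hT : ∀ᶠ r in 𝓝[>] (0 : ℝ), IsExpanding q r T) {n : ℕ}
    (A : Matrix (Fin n) (Fin n) (RobbaInt Γ K)) (v : Fin n → RobbaCompletion Γ K)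
    (h : (A.map fun a => bdToCompletion Γ K (intToBd Γ K a)).mulVec v = fun i => T (v i)) :
    ∃ w : Fin n → RobbaBd Γ K, ∀ i, v i = bdToCompletion Γ K (w i) := by
  have hA : ∀ᶠ r in 𝓝[>] (0 : ℝ), ∀ α β, ∃ C, ∀ i,
      ‖coeff i (A α β).1‖ ≤ C * Real.exp (r * expo i) :=
    eventually_all.2 fun α => eventually_all.2 fun β =>
      (A α β).1.2.eventually_bound
  obtain ⟨r, ⟨hTr, hAr⟩, hr⟩ := ((hT.and hA).and self_mem_nhdsWithin).exists
  replace hr : 0 < r := hr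
  have hq0 : (0 : ℝ) < q := by exact_mod_cast zero_lt_one.trans hq
  choose C' hC' using hAr
  obtain ⟨C, hC1, hC⟩ : ∃ C : ℝ, 1 ≤ C ∧ ∀ α β i,
      ‖coeff i (A α β).1‖ ≤ C * Real.exp (r * expo i) := by
    refine ⟨1 + ∑ α, ∑ β, |C' α β|, le_add_of_nonneg_right (by positivity), fun α β i => ?_⟩
    refine (hC' α β i).trans (mul_le_mul_of_nonneg_right ?_ (Real.exp_pos _).le)
    have h1 : |C' α β| ≤ ∑ β, |C' α β| :=
      Finset.single_le_sum (f := fun β => |C' α β|) (fun _ _ => abs_nonneg _) (Finset.mem_univ β)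
    have h2 : ∑ β, |C' α β| ≤ ∑ α, ∑ β, |C' α β| :=
      Finset.single_le_sum (f := fun α => ∑ β, |C' α β|)
        (fun _ _ => Finset.sum_nonneg fun _ _ => abs_nonneg _) (Finset.mem_univ α)
    linarith [le_abs_self (C' α β)]
  obtain ⟨M, hM1, hM⟩ : ∃ M : ℝ, 1 ≤ M ∧ ∀ α i, ‖completionCoeff i (v α)‖ ≤ M := by
    refine ⟨1 + ∑ α, ‖v α‖, le_add_of_nonneg_right (by positivity), fun α i => ?_⟩
    have h1 : ‖v α‖ ≤ ∑ α, ‖v α‖ :=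
      Finset.single_le_sum (f := fun α => ‖v α‖) (fun _ _ => norm_nonneg _) (Finset.mem_univ α)
    linarith [norm_completionCoeff_le (v α) i]
  -- one step of the recursion for the weights of large coefficients
  have step : ∀ α i c, 0 < c → c ≤ ‖completionCoeff i (v α)‖ → ∃ β k,
      c ≤ ‖completionCoeff k (v β)‖ ∧
      ‖completionCoeff i (v α)‖ * Real.exp (-(q * r * expo i)) ≤
        C * (‖completionCoeff k (v β)‖ * Real.exp (-(r * expo k))) := by
    intro α i c hc hi
    obtain ⟨m, hm, hle⟩ := hTr (v α) i c hc hi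
    have h1 : completionCoeff m (T (v α)) =
        ∑ β, completionCoeff m (bdToCompletion Γ K (intToBd Γ K (A α β)) * v β) := by
      rw [← map_sum]
      exact congrArg _ (congrFun h α).symm
    have h0 : 0 < ‖completionCoeff m (T (v α))‖ := hc.trans_le hm
    have hn : (Finset.univ : Finset (Fin n)).Nonempty := ⟨α, Finset.mem_univ α⟩
    obtain ⟨β, -, hβ⟩ := IsUltrametricDist.exists_norm_finsetSum_le_of_nonempty hn
      fun β => completionCoeff m (bdToCompletion Γ K (intToBd Γ K (A α β)) * v β)
    rw [← h1] at hβ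
    obtain ⟨j, hj⟩ := exists_norm_completionCoeff_mul_le (A α β) (v β)
      (norm_pos_iff.1 (h0.trans_le hβ))
    replace hj := hβ.trans hj
    -- Integrality of the entry of `A` keeps the new coefficient above the threshold `c`; its growth
    -- bound costs the factor `C`.
    refine ⟨β, m - j, hm.trans (hj.trans (mul_le_of_le_one_left (norm_nonneg _)
      ((A α β).2 j))), hle.trans ?_⟩
    calc ‖completionCoeff m (T (v α))‖ * Real.exp (-(r * expo m))
        ≤ (C * Real.exp (r * expo j)) * ‖completionCoeff (m - j) (v β)‖ *
            Real.exp (-(r * expo m)) := by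
          gcongr
          exact hj.trans (mul_le_mul_of_nonneg_right (hC α β j) (norm_nonneg _))
      _ = C * (‖completionCoeff (m - j) (v β)‖ *
            (Real.exp (r * expo j) * Real.exp (-(r * expo m)))) := by ring
      _ = _ := by
          rw [← Real.exp_add]
          simp only [expo, map_sub]
          ring_nf
  have bound : ∀ α i, ‖completionCoeff i (v α)‖ ≤
      C ^ q * M ^ (q - 1) * Real.exp (q * r * expo i) := by
    intro α i
    rcases eq_or_ne (completionCoeff i (v α)) 0 with h0 | h0
    · rw [h0, norm_zero]
      positivity
    -- The threshold is the coefficient to be bounded. It serves only to make the supremum over `S`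
    -- finite, and the final constant is independent of it.
    obtain ⟨c, hc⟩ : ∃ c, c = ‖completionCoeff i (v α)‖ := ⟨_, rfl⟩
    have hc0 : 0 < c := hc ▸ norm_pos_iff.2 h0
    let W : Fin n × Γ → ℝ := fun p =>
      ‖completionCoeff p.2 (v p.1)‖ * Real.exp (-(q * r * expo p.2))
    let S : Set (Fin n × Γ) := {p | c ≤ ‖completionCoeff p.2 (v p.1)‖}
    have hS : BddAbove (W '' S) := by
      have hlow : ∀ β : Fin n, ∃ l : ℝ, ∀ k, c ≤ ‖completionCoeff k (v β)‖ → l ≤ expo k := by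
        intro β
        have hwf := isWF_completionCoeff (v β) hc0
        by_cases hne : {k | c ≤ ‖completionCoeff k (v β)‖}.Nonempty
        · exact ⟨expo (hwf.min hne), fun k hk =>
            RealExponents.strictMono.monotone (hwf.min_le hne hk)⟩
        · exact ⟨0, fun k hk => absurd ⟨k, hk⟩ hne⟩
      choose l hl using hlow
      refine ⟨M * ∑ β, Real.exp (-(q * r * l β)), ?_⟩
      rintro _ ⟨⟨β, k⟩, hk, rfl⟩
      refine mul_le_mul (hM β k) ?_ (Real.exp_pos _).le (by linarith)
      refine le_trans ?_ (Finset.single_le_sum (f := fun β => Real.exp (-(q * r * l β)))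
        (fun _ _ => (Real.exp_pos _).le) (Finset.mem_univ β))
      have := hl β k hk
      gcongr
    have hmem : W (α, i) ∈ W '' S := ⟨(α, i), hc.le, rfl⟩
    have hWi : 0 < W (α, i) := mul_pos (norm_pos_iff.2 h0) (Real.exp_pos _)
    obtain ⟨P, hP⟩ : ∃ P, P = sSup (W '' S) := ⟨_, rfl⟩
    have hP0 : 0 < P := hWi.trans_le (hP ▸ le_csSup hS hmem)
    have hpow : ∀ p ∈ S, W p ^ q ≤ C ^ q * M ^ (q - 1) * P := by
      intro p hp
      obtain ⟨β, k, hk, hle⟩ := step p.1 p.2 c hc0 hp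
      have hWk : W (β, k) ≤ P := hP ▸ le_csSup hS ⟨(β, k), hk, rfl⟩
      have hW0 : 0 ≤ W (β, k) := by positivity
      have hWp : 0 ≤ W p := by positivity
      calc W p ^ q ≤ (C * (‖completionCoeff k (v β)‖ * Real.exp (-(r * expo k)))) ^ q :=
            pow_le_pow_left₀ hWp hle q
        -- The `q`-th power turns radius `r` into radius `qr`; the `q - 1` spare factors of the
        -- coefficient are absorbed by `M`.
        _ = C ^ q * ‖completionCoeff k (v β)‖ ^ (q - 1) * W (β, k) := by
            obtain ⟨q, rfl⟩ : ∃ m, q = m + 1 := ⟨q - 1, by omega⟩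
            have : Real.exp (-(r * expo k)) ^ (q + 1) =
                Real.exp (-(((q + 1 : ℕ) : ℝ) * r * expo k)) := by
              rw [← Real.exp_nat_mul]
              ring_nf
            rw [mul_pow, mul_pow, this, Nat.add_sub_cancel]
            change _ = _ * (‖completionCoeff k (v β)‖ * _)
            ring
        _ ≤ _ := by
            gcongr
            exact hM β k
    have hD1 : 1 ≤ C ^ q * M ^ (q - 1) :=
      one_le_mul_of_one_le_of_one_le (one_le_pow₀ hC1) (one_le_pow₀ hM1)
    have hP1 : P ≤ max 1 √(C ^ q * M ^ (q - 1) * P) := by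
      rw [hP]
      refine csSup_le ⟨_, hmem⟩ ?_
      rintro _ ⟨p, hp, rfl⟩
      rw [← hP]
      -- Since `q ≥ 2`, a weight at least `1` satisfies `W p ^ 2 ≤ W p ^ q`. Square roots then
      -- suffice, giving a bound weaker than the optimal one, and `1 ≤ C, M` covers weights below
      -- `1`.
      rcases le_total (W p) 1 with h1 | h1
      · exact le_max_of_le_left h1
      · exact le_max_of_le_right
          (Real.le_sqrt_of_sq_le ((pow_le_pow_right₀ h1 hq).trans (hpow p hp)))
    have hP2 : P ≤ C ^ q * M ^ (q - 1) := by
      rcases le_max_iff.1 hP1 with h1 | h1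
      · exact h1.trans hD1
      · rw [Real.le_sqrt' hP0, sq] at h1
        exact le_of_mul_le_mul_right h1 hP0
    have hW : W (α, i) ≤ C ^ q * M ^ (q - 1) := (hP ▸ le_csSup hS hmem).trans hP2
    change _ * Real.exp (-(q * r * expo i)) ≤ _ at hW
    rwa [Real.exp_neg, ← div_eq_mul_inv, div_le_iff₀ (Real.exp_pos _)] at hW
  choose w hw using fun α => exists_bd_of_bound (v α) (by positivity : 0 < q * r) (bound α)
  exact ⟨w, hw⟩

end Coefficients


/-! ### Expansion on the completion, and the extended Frobenius -/

section ExtendedFrobenius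

variable {K : Type*} [NontriviallyNormedField K] [IsUltrametricDist K] [CompleteSpace K]

theorem continuous_completionMap {Γ : Type} [AddCommGroup Γ] [LinearOrder Γ]
    [IsOrderedAddMonoid Γ] [RealExponents Γ] (φ : Robba Γ K →+* Robba Γ K)
    (h : NonIncreasing φ) : Continuous (completionMap φ h) :=
  UniformSpace.Completion.continuous_map

theorem completionMap_coe {Γ : Type} [AddCommGroup Γ] [LinearOrder Γ]
    [IsOrderedAddMonoid Γ] [RealExponents Γ] (φ : Robba Γ K →+* Robba Γ K)
    (h : NonIncreasing φ) (f : RobbaBd Γ K) :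
    completionMap φ h (bdToCompletion Γ K f) = bdToCompletion Γ K (restrictBd φ h f) :=
  UniformSpace.Completion.map_coe
    (uniformContinuous_addMonoidHom_of_continuous (continuous_restrictBd φ h)) f

/-- Expansion concerns only coefficients of norm at least `c`, and these keep their norms when `x`
and its image are both approximated within `c`. -/
theorem isExpanding_completionMap_of_bd {Γ : Type} [AddCommGroup Γ] [LinearOrder Γ]
    [IsOrderedAddMonoid Γ] [RealExponents Γ] {q : ℕ} {r : ℝ} (φ : Robba Γ K →+* Robba Γ K)
    (h : NonIncreasing φ)
    (hφ : ∀ (f : RobbaBd Γ K) (i : Γ) (c : ℝ), 0 < c → c ≤ ‖coeff i f.1‖ →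
      ∃ n, c ≤ ‖coeff n (φ f.1)‖ ∧ ‖coeff i f.1‖ * Real.exp (-(q * r * expo i)) ≤
        ‖coeff n (φ f.1)‖ * Real.exp (-(r * expo n))) :
    IsExpanding q r (completionMap φ h) := by
  intro x i c hc hi
  obtain ⟨f, hf, hg⟩ := exists_approx (continuous_completionMap φ h) x hc
  have h1 := norm_eq_of_norm_sub_lt ((hf i).trans_le hi)
  obtain ⟨n, hn, hle⟩ := hφ f i c hc (hi.trans h1.ge)
  have h2 := hg n
  rw [completionMap_coe, completionCoeff_coe] at h2
  change ‖_ - coeff n (φ f.1)‖ < c at h2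
  rw [norm_sub_rev] at h2
  have h3 := norm_eq_of_norm_sub_lt (h2.trans_le hn)
  refine ⟨n, hn.trans h3.ge, ?_⟩
  rw [h3, ← h1]
  exact hle

theorem isExpanding_extendedFrobeniusCompletion (φK : K →+* K) (hφ : ∀ x, ‖φK x‖ = ‖x‖) (q : ℕ)
    (hq : 0 < q) (r : ℝ) : IsExpanding q r (extendedFrobeniusCompletion φK hφ q hq) := by
  refine isExpanding_completionMap_of_bd _ _ fun f i c hc hi => ⟨q * i, ?_⟩
  have hq' : (q : ℚ) ≠ 0 := by exact_mod_cast hq.ne'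
  rw [coeff_extendedFrobenius, hφ, mul_div_cancel_left₀ i hq']
  refine ⟨hi, le_of_eq ?_⟩
  congr 3
  change q * r * (i : ℝ) = r * ((q * i : ℚ) : ℝ)
  push_cast
  ring

end ExtendedFrobenius

/-! ### Discreteness and weighted coefficient bounds -/

section RelativeFrobenius

variable {K : Type*} [NontriviallyNormedField K] [IsUltrametricDist K] [CompleteSpace K]

variable (K) in
-- The norm of a uniformizer works. The gap below `1` turns coefficientwise smallness of `u - t^q`
-- into uniform smallness.
theorem exists_norm_le_of_norm_lt_one
    [IsDiscreteValuationRing (NormedField.valuation (K := K)).valuationSubring] :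
    ∃ ρ : ℝ, 0 < ρ ∧ ρ < 1 ∧ ∀ x : K, ‖x‖ < 1 → ‖x‖ ≤ ρ := by
  obtain ⟨p, hp⟩ := IsDiscreteValuationRing.exists_irreducible
    (NormedField.valuation (K := K)).valuationSubring
  have hmem : ∀ x : (NormedField.valuation (K := K)).valuationSubring,
      x ∈ IsLocalRing.maximalIdeal (NormedField.valuation (K := K)).valuationSubring ↔
        ‖(x : K)‖ < 1 := fun x => by
    rw [Valuation.mem_maximalIdeal_iff, NormedField.valuation_apply, ← NNReal.coe_lt_coe]
    rfl
  have hle : ∀ x : (NormedField.valuation (K := K)).valuationSubring, ‖(x : K)‖ ≤ 1 :=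
    fun x => x.2
  have hm := hp.maximalIdeal_eq
  refine ⟨‖(p : K)‖, norm_pos_iff.2 fun h => hp.ne_zero (Subtype.ext h), (hmem p).1 ?_,
    fun x hx => ?_⟩
  · rw [hm]
    exact Ideal.mem_span_singleton_self p
  · have hx' : x ∈ (NormedField.valuation (K := K)).valuationSubring := hx.le
    obtain ⟨y, hy⟩ := Ideal.mem_span_singleton.1 (hm ▸ (hmem ⟨x, hx'⟩).2 hx)
    have h1 : x = p * y := congrArg Subtype.val hy
    rw [h1, norm_mul]
    exact mul_le_of_le_one_right (norm_nonneg _) (hle y)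

theorem norm_coeff_mul_le_exp {r C D : ℝ} {f g : Robba ℤ K}
    (hf : ∀ n, ‖coeff n f‖ ≤ C * Real.exp (r * n))
    (hg : ∀ n, ‖coeff n g‖ ≤ D * Real.exp (r * n)) (n : ℤ) :
    ‖coeff n (f * g)‖ ≤ C * D * Real.exp (r * n) := by
  have hC : 0 ≤ C := by simpa using (norm_nonneg _).trans (hf 0)
  have hD : 0 ≤ D := by simpa using (norm_nonneg _).trans (hg 0)
  refine norm_conv_le (by positivity) fun i => ?_
  refine (mul_le_mul (hf i) (hg (n - i)) (norm_nonneg _) (by positivity)).trans_eq ?_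
  rw [mul_mul_mul_comm, ← Real.exp_add]
  push_cast
  ring_nf

theorem norm_coeff_add_le_exp {r C : ℝ} {f g : Robba ℤ K}
    (hf : ∀ n, ‖coeff n f‖ ≤ C * Real.exp (r * n))
    (hg : ∀ n, ‖coeff n g‖ ≤ C * Real.exp (r * n)) (n : ℤ) :
    ‖coeff n (f + g)‖ ≤ C * Real.exp (r * n) :=
  (IsUltrametricDist.norm_add_le_max _ _).trans (max_le (hf n) (hg n))

@[simp] theorem coeff_monomial_self (d : ℤ) (x : K) : coeff d (monomial d x) = x :=
  Pi.single_eq_same _ _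

theorem coeff_monomial_of_ne {d n : ℤ} (h : n ≠ d) (x : K) : coeff n (monomial d x) = 0 :=
  Pi.single_eq_of_ne h _

theorem norm_coeff_monomial_le (r : ℝ) (d n : ℤ) :
    ‖coeff n (monomial d 1 : Robba ℤ K)‖ ≤ Real.exp (-(r * d)) * Real.exp (r * n) := by
  by_cases h : n = d
  · subst h
    rw [coeff_monomial_self, norm_one, ← Real.exp_add]
    simp
  · rw [coeff_monomial_of_ne h, norm_zero]
    positivity

theorem monomial_mul_monomial (d e : ℤ) :
    (monomial d 1 * monomial e 1 : Robba ℤ K) = monomial (d + e) 1 := by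
  refine Robba.ext fun n => ?_
  rw [coeff_mul, tsum_eq_single d fun i hi => by rw [coeff_monomial_of_ne hi, zero_mul],
    coeff_monomial_self, one_mul]
  by_cases h : n = d + e
  · subst h
    rw [add_sub_cancel_left, coeff_monomial_self, coeff_monomial_self]
  · rw [coeff_monomial_of_ne h, coeff_monomial_of_ne (by omega)]

/-! ### Series close to a monomial -/

/-- The series `f` is close to `t^d` for the weighted norm of radius `e^{-r}`. -/
def IsNearMonomial (θ r : ℝ) (d : ℤ) (f : Robba ℤ K) : Prop :=
  ∀ n : ℤ, ‖coeff n (f - monomial d 1)‖ ≤ θ * Real.exp (-(r * d)) * Real.exp (r * n)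

namespace IsNearMonomial

variable {θ r : ℝ} {d e : ℤ} {f g : Robba ℤ K}

theorem one (hθ : 0 ≤ θ) : IsNearMonomial θ r 0 (1 : Robba ℤ K) := fun n => by
  rw [← one_eq_monomial, sub_self, coeff_zero, norm_zero]
  positivity

theorem mul (hθ : 0 ≤ θ) (hθ1 : θ ≤ 1) (hf : IsNearMonomial θ r d f)
    (hg : IsNearMonomial θ r e g) : IsNearMonomial θ r (d + e) (f * g) := by
  have h : f * g - monomial (d + e) 1 = (f - monomial d 1) * (g - monomial e 1) +
      (monomial d 1 * (g - monomial e 1) + (f - monomial d 1) * monomial e 1) := by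
    rw [← monomial_mul_monomial]
    ring
  have hE : Real.exp (-(r * ((d + e : ℤ) : ℝ))) =
      Real.exp (-(r * d)) * Real.exp (-(r * e)) := by
    rw [← Real.exp_add]
    push_cast
    ring_nf
  unfold IsNearMonomial
  rw [h, hE]
  refine norm_coeff_add_le_exp (fun n => ?_) (norm_coeff_add_le_exp (fun n => ?_) fun n => ?_)
  · refine (norm_coeff_mul_le_exp hf hg n).trans ?_
    rw [mul_mul_mul_comm]
    gcongr
    exact mul_le_of_le_one_left hθ hθ1
  · refine (norm_coeff_mul_le_exp (norm_coeff_monomial_le r d) hg n).trans_eq ?_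
    ring
  · refine (norm_coeff_mul_le_exp hf (norm_coeff_monomial_le r e) n).trans_eq ?_
    ring

/-- From `g - t^{-d} = -t^{-d} g (f - t^d)`, the weighted norm `B` of `g` is at most `max (θB)
e^{rd}`. The a priori bound on `g` makes `B` finite, so `θ < 1` gives `B ≤ e^{rd}`, and the identity
then gives closeness. -/
theorem of_mul_eq_one (hθ : 0 ≤ θ) (hθ1 : θ < 1) (hf : IsNearMonomial θ r d f) (hfg : f * g = 1)
    (hg : ∃ C, ∀ n, ‖coeff n g‖ ≤ C * Real.exp (r * n)) : IsNearMonomial θ r (-d) g := by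
  obtain ⟨C, hC⟩ := hg
  have hpos : ∀ n : ℤ, 0 < Real.exp (r * n) := fun n => Real.exp_pos _
  let w : ℤ → ℝ := fun n => ‖coeff n g‖ / Real.exp (r * n)
  have hbdd : BddAbove (Set.range w) :=
    ⟨C, by rintro _ ⟨n, rfl⟩; exact (div_le_iff₀ (hpos n)).2 (hC n)⟩
  obtain ⟨B, hB⟩ : ∃ B, B = ⨆ n, w n := ⟨_, rfl⟩
  have hgB : ∀ n, ‖coeff n g‖ ≤ B * Real.exp (r * n) := fun n =>
    (div_le_iff₀ (hpos n)).1 (hB ▸ le_ciSup hbdd n)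
  have hE : Real.exp (-(r * ((-d : ℤ) : ℝ))) * Real.exp (-(r * d)) = 1 := by
    rw [← Real.exp_add]
    simp
  have key : g - monomial (-d) 1 = -(monomial (-d) 1 * (g * (f - monomial d 1))) := by
    have h1 : (monomial (-d) 1 * monomial d 1 : Robba ℤ K) = 1 := by
      rw [monomial_mul_monomial, neg_add_cancel, one_eq_monomial]
    linear_combination monomial (-d) 1 * hfg - g * h1
  have hdiff : ∀ n : ℤ, ‖coeff n (g - monomial (-d) 1)‖ ≤ θ * B * Real.exp (r * n) := fun n => by
    rw [key, coeff_neg, norm_neg]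
    refine (norm_coeff_mul_le_exp (norm_coeff_monomial_le r (-d))
      (norm_coeff_mul_le_exp hgB hf) n).trans_eq ?_
    linear_combination (θ * B * Real.exp (r * n)) * hE
  have hmax : B ≤ max (θ * B) (Real.exp (-(r * ((-d : ℤ) : ℝ)))) := by
    rw [hB]
    refine ciSup_le fun n => (div_le_iff₀ (hpos n)).2 ?_
    rw [← hB]
    have h1 := norm_coeff_add_le_exp
      (fun n => (hdiff n).trans (mul_le_mul_of_nonneg_right (le_max_left _ _) (hpos n).le))
      (fun n => (norm_coeff_monomial_le r (-d) n).trans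
        (mul_le_mul_of_nonneg_right (le_max_right _ _) (hpos n).le)) n
    rwa [sub_add_cancel] at h1
  have hB1 : B ≤ Real.exp (-(r * ((-d : ℤ) : ℝ))) := by
    rcases le_max_iff.1 hmax with h1 | h1
    · have : B ≤ 0 := by nlinarith
      exact this.trans (Real.exp_pos _).le
    · exact h1
  intro n
  refine (hdiff n).trans ?_
  gcongr

/-- The ultrametric inequality prevents errors from accumulating, so one `θ` and one `r` serve all
integer powers. -/
theorem zpow (hθ : 0 ≤ θ) (hθ1 : θ < 1) (u : (RobbaInt ℤ K)ˣ)
    (hu : IsNearMonomial θ r d (u : RobbaInt ℤ K).1)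
    (hb : ∃ C, ∀ n, ‖coeff n ((u⁻¹ : (RobbaInt ℤ K)ˣ) : RobbaInt ℤ K).1‖ ≤ C * Real.exp (r * n))
    (i : ℤ) : IsNearMonomial θ r (d * i) ((u ^ i : (RobbaInt ℤ K)ˣ) : RobbaInt ℤ K).1 := by
  have hinv : IsNearMonomial θ r (-d) ((u⁻¹ : (RobbaInt ℤ K)ˣ) : RobbaInt ℤ K).1 :=
    of_mul_eq_one hθ hθ1 hu (congrArg Subtype.val u.mul_inv) hb
  induction i using Int.induction_on with
  | zero => simpa using one hθ
  | succ i ih =>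
    rw [zpow_add_one, mul_add_one]
    exact ih.mul hθ hθ1.le hu
  | pred i ih =>
    rw [zpow_sub_one, mul_sub_one, sub_eq_add_neg]
    exact ih.mul hθ hθ1.le hinv

theorem norm_coeff_self (hθ1 : θ < 1) (hf : IsNearMonomial θ r d f) : ‖coeff d f‖ = 1 := by
  have h1 := hf d
  rw [mul_assoc, ← Real.exp_add, neg_add_cancel, Real.exp_zero, mul_one, sub_eq_add_neg,
    coeff_add, coeff_neg, coeff_monomial_self, ← sub_eq_add_neg, norm_sub_rev] at h1
  simpa using norm_eq_of_norm_sub_lt (x := (1 : K)) (by rw [norm_one]; exact h1.trans_lt hθ1)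

theorem norm_coeff_lt_of_ne (hθ1 : θ < 1) (hf : IsNearMonomial θ r d f) {n : ℤ} (hn : n ≠ d) :
    ‖coeff n f‖ < Real.exp (-(r * d)) * Real.exp (r * n) := by
  have h1 := hf n
  rw [sub_eq_add_neg, coeff_add, coeff_neg, coeff_monomial_of_ne hn, neg_zero, add_zero] at h1
  refine h1.trans_lt ?_
  rw [mul_assoc]
  exact mul_lt_of_lt_one_left (by positivity) hθ1

end IsNearMonomial

/-- A series which is close to `t^d` for the Gauss norm is so for the weighted norms of radius close
to `1`. -/
theorem eventually_isNearMonomial {ρ θ : ℝ} (hρ : 0 < ρ) (hρθ : ρ < θ) {d : ℤ}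
    {f : Robba ℤ K} (hf : ∀ n, ‖coeff n (f - monomial d 1)‖ ≤ ρ) :
    ∀ᶠ r in 𝓝[>] (0 : ℝ), IsNearMonomial θ r d f := by
  obtain ⟨-, s, hs, h⟩ := inRobba_iff.1 (f - monomial d 1).2
  obtain ⟨C, hC⟩ := h s hs le_rfl
  replace hC : ∀ n : ℤ, ‖coeff n (f - monomial d 1)‖ ≤ C * Real.exp (s * n) := hC
  have hC0 : 0 ≤ C := by simpa using (norm_nonneg _).trans (hC 0)
  -- below `-N` the growth bound is the stronger one
  obtain ⟨N, hN⟩ : ∃ N : ℝ, ∀ x : ℝ, x ≤ -N → C * Real.exp (s / 2 * x) ≤ ρ := by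
    have h1 : Tendsto (fun x : ℝ => C * Real.exp (s / 2 * x)) atBot (𝓝 (C * 0)) :=
      (Real.tendsto_exp_atBot.comp (tendsto_id.const_mul_atBot (half_pos hs))).const_mul C
    rw [mul_zero] at h1
    obtain ⟨y, hy⟩ := eventually_atBot.1 (h1.eventually (ge_mem_nhds hρ))
    exact ⟨-y, fun x hx => hy x (by linarith)⟩
  have hlim : ∀ y : ℝ, ∀ᶠ r in 𝓝[>] (0 : ℝ), ρ < θ * Real.exp (-(r * y)) := fun y => by
    have h2 : Tendsto (fun r : ℝ => θ * Real.exp (-(r * y))) (𝓝 0) (𝓝 (θ * Real.exp (-(0 * y)))) :=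
      Continuous.tendsto (by fun_prop) 0
    rw [zero_mul, neg_zero, Real.exp_zero, mul_one] at h2
    exact (h2.mono_left nhdsWithin_le_nhds).eventually (lt_mem_nhds hρθ)
  -- The first condition handles `n ≥ -N`. The second handles `n ≤ -N`, where `n` may still be
  -- nonnegative because `N` may be negative; for negative `n`, half of the decay rate `s` gains the
  -- factor `ρ` and the other half beats `e^{rn}`.
  filter_upwards [hlim (d + N), hlim d, Ioc_mem_nhdsGT (half_pos hs)] with r h1 h2 hr n
  have hr0 : 0 < r := hr.1
  have hθ : 0 < θ := hρ.trans hρθ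
  rcases le_total (-N) (n : ℝ) with hn | hn
  · refine (hf n).trans (h1.le.trans ?_)
    rw [mul_assoc, ← Real.exp_add]
    gcongr
    nlinarith
  · rcases le_total 0 (n : ℝ) with hn0 | hn0
    · refine (hf n).trans (h2.le.trans ?_)
      exact le_mul_of_one_le_right (by positivity) (Real.one_le_exp (by positivity))
    · calc ‖coeff n (f - monomial d 1)‖ ≤ C * Real.exp (s * n) := hC n
        _ = C * Real.exp (s / 2 * n) * Real.exp (s / 2 * n) := by
            rw [mul_assoc, ← Real.exp_add]
            ring_nf
        _ ≤ ρ * Real.exp (r * n) := by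
            refine mul_le_mul (hN n hn) (Real.exp_le_exp.2 ?_) (Real.exp_pos _).le hρ.le
            exact mul_le_mul_of_nonpos_right hr.2 hn0
        _ ≤ _ := mul_le_mul_of_nonneg_right h2.le (Real.exp_pos _).le

/-- Among the coefficients of size at least `c`, one has maximal weight. -/
theorem exists_forall_weight_le (f : RobbaBd ℤ K) {c s : ℝ} (hc : 0 < c) (hs : 0 < s) {i : ℤ}
    (hi : c ≤ ‖coeff i f.1‖) : ∃ k, c ≤ ‖coeff k f.1‖ ∧ ∀ j, c ≤ ‖coeff j f.1‖ →
      ‖coeff j f.1‖ * Real.exp (-(s * j)) ≤ ‖coeff k f.1‖ * Real.exp (-(s * k)) := by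
  let W : ℤ → ℝ := fun j => ‖coeff j f.1‖ * Real.exp (-(s * j))
  have hwf : {j | c ≤ ‖coeff j f.1‖}.IsWF := (inRobba_iff.1 f.1.2).1 c hc
  have hWi : 0 < W i := mul_pos (hc.trans_le hi) (Real.exp_pos _)
  have htop : Tendsto W atTop (𝓝 0) := by
    obtain ⟨r', -, h⟩ := f.1.2
    exact h.tendsto_atTop s hs
  obtain ⟨y, hy⟩ := eventually_atTop.1 (htop.eventually (gt_mem_nhds hWi))
  -- Well-ordering bounds these exponents below, and decay of the weights bounds them above.
  have hfin : {j | c ≤ ‖coeff j f.1‖ ∧ W i ≤ W j}.Finite := by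
    refine (Set.finite_Icc (hwf.min ⟨i, hi⟩) y).subset fun j hj => ⟨hwf.min_le _ hj.1, ?_⟩
    by_contra! hlt
    exact absurd hj.2 (not_le.2 (hy j hlt.le))
  obtain ⟨k, hk, hmax⟩ := Set.exists_max_image _ W hfin ⟨i, hi, le_rfl⟩
  refine ⟨k, hk.1, fun j hj => ?_⟩
  rcases le_total (W i) (W j) with h | h
  · exact hmax j ⟨hj, h⟩
  · exact h.trans hk.2

/-! ### Expansion by a relative Frobenius lift -/

/-- The witness need not come from the given coefficient `i`: cancellation could destroy its
contribution. The coefficient `k` of maximal weight in radius `qr` is protected from cancellation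
and has at least the weight of `i`. -/
theorem RelativeFrobeniusLift.eventually_isExpanding
    [IsDiscreteValuationRing (NormedField.valuation (K := K)).valuationSubring] {q : ℕ}
    (hq : 0 < q) (φ : RelativeFrobeniusLift K q) :
    ∀ᶠ r in 𝓝[>] (0 : ℝ), IsExpanding q r φ.onCompletion := by
  obtain ⟨ρ, hρ0, hρ1, hρ⟩ := exists_norm_le_of_norm_lt_one K
  obtain ⟨θ, hρθ, hθ1⟩ := exists_between hρ1
  have hθ0 : 0 ≤ θ := hρ0.le.trans hρθ.le
  filter_upwards [eventually_isNearMonomial hρ0 hρθ fun n => hρ _ (φ.u_sub n),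
    (((φ.u⁻¹ : (RobbaInt ℤ K)ˣ) : RobbaInt ℤ K).1.2).eventually_bound,
    self_mem_nhdsWithin] with r hu hinv hr
  replace hr : 0 < r := hr
  have hpow := IsNearMonomial.zpow hθ0 hθ1 φ.u hu hinv
  have hq0 : (0 : ℝ) < q := by exact_mod_cast hq
  refine isExpanding_completionMap_of_bd _ _ fun f i c hc hi => ?_
  obtain ⟨k, hk, hmax⟩ := exists_forall_weight_le f hc (mul_pos hq0 hr) hi
  have hterm : ‖φ.φK (coeff k f.1) *
      coeff (q * k) ((φ.u ^ k : (RobbaInt ℤ K)ˣ) : RobbaInt ℤ K).1‖ = ‖coeff k f.1‖ := by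
    rw [norm_mul, φ.isometry, (hpow k).norm_coeff_self hθ1, mul_one]
  have hn : ‖coeff (q * k) (φ.toRingHom f.1)‖ = ‖coeff k f.1‖ := by
    refine (norm_eq_of_hasSum_of_dominant (φ.hasSum_coeff f.1 (q * k)) (k := k)
      (hterm ▸ hc.trans_le hk) fun j hj => ?_).trans hterm
    rw [hterm, norm_mul, φ.isometry]
    -- Small coefficients lose because powers of `u` are integral. Large ones lose because
    -- maximality of `k` compensates the exponential factor, with strictness coming from `u^j` being
    -- close to a monomial of a different degree.
    rcases lt_or_ge ‖coeff j f.1‖ c with hlt | hge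
    · exact (mul_le_of_le_one_right (norm_nonneg _)
        (((φ.u ^ j : (RobbaInt ℤ K)ˣ) : RobbaInt ℤ K).2 _)).trans_lt (hlt.trans_le hk)
    · have hne : (q : ℤ) * k ≠ q * j := fun h =>
        hj (mul_left_cancel₀ (by exact_mod_cast hq.ne') h).symm
      calc _ < ‖coeff j f.1‖ *
            (Real.exp (-(r * ((q * j : ℤ) : ℝ))) * Real.exp (r * ((q * k : ℤ) : ℝ))) :=
            mul_lt_mul_of_pos_left ((hpow j).norm_coeff_lt_of_ne hθ1 hne) (hc.trans_le hge)
        _ = ‖coeff j f.1‖ * Real.exp (-(q * r * j)) * Real.exp (q * r * k) := by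
            push_cast
            ring_nf
        _ ≤ ‖coeff k f.1‖ * Real.exp (-(q * r * k)) * Real.exp (q * r * k) :=
            mul_le_mul_of_nonneg_right (hmax j hge) (Real.exp_pos _).le
        _ = ‖coeff k f.1‖ := by
            rw [mul_assoc, ← Real.exp_add, neg_add_cancel, Real.exp_zero, mul_one]
  refine ⟨q * k, hn ▸ hk, ?_⟩
  rw [hn]
  refine (hmax i hi).trans_eq ?_
  congr 3
  change q * r * (k : ℝ) = r * ((q * k : ℤ) : ℝ)
  push_cast
  ring

end RelativeFrobenius

end RelFrob

theorem proposition2p5p6 {K : Type*} [NontriviallyNormedField K] [IsUltrametricDist K]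
    [CompleteSpace K] [IsDiscreteValuationRing (NormedField.valuation (K := K)).valuationSubring]
    (q : ℕ) (hq : 1 < q) :
    (∀ (φK : K →+* K) (hφ : ∀ x, ‖φK x‖ = ‖x‖) (n : ℕ)
      (A : Matrix (Fin n) (Fin n) (RelFrob.RobbaInt ℚ K))
      (v : Fin n → RelFrob.RobbaCompletion ℚ K),
      (A.map fun a => RelFrob.bdToCompletion ℚ K (RelFrob.intToBd ℚ K a)).mulVec v =
        (fun i => RelFrob.extendedFrobeniusCompletion φK hφ q (zero_lt_one.trans hq) (v i)) →
      ∃ w : Fin n → RelFrob.RobbaBd ℚ K, ∀ i, v i = RelFrob.bdToCompletion ℚ K (w i)) ∧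
    (∀ (φ : RelFrob.RelativeFrobeniusLift K q) (n : ℕ)
      (A : Matrix (Fin n) (Fin n) (RelFrob.RobbaInt ℤ K))
      (v : Fin n → RelFrob.RobbaCompletion ℤ K),
      (A.map fun a => RelFrob.bdToCompletion ℤ K (RelFrob.intToBd ℤ K a)).mulVec v =
        (fun i => φ.onCompletion (v i)) →
      ∃ w : Fin n → RelFrob.RobbaBd ℤ K, ∀ i, v i = RelFrob.bdToCompletion ℤ K (w i)) := by
  have hq0 : 0 < q := zero_lt_one.trans hq
  exact ⟨fun φK hφ _ A v h => RelFrob.exists_bd_of_mulVec_eq hq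
      (Eventually.of_forall (RelFrob.isExpanding_extendedFrobeniusCompletion φK hφ q hq0)) A v h,
    fun φ _ A v h => RelFrob.exists_bd_of_mulVec_eq hq (φ.eventually_isExpanding hq0) A v h⟩
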